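/- Let $n\ge 2$, let $M$ be a connected smooth $n$-dimensional manifold (Hausdorff, second countable, without boundary), let $\omega$ be a volume element on $M$ (a smooth nowhere vanishing $n$-form; equivalently, an $\operatorname{SL}(n,\mathbb R)$-structure), and give $M$ the orientation for which $\omega>0$. Let a flow with velocity field $\xi$ be given on $M$: $\xi$ is a smooth vector field and $\phi_t$ is its smooth local flow, i.e. $\phi_0=\mathrm{id}$, near every point $(t,x)\mapsto\phi_t(x)$ is smooth for small $|t|$, and the curves $t\mapsto\phi_t(x)$ are trajectories of $\xi$. For functions and $n$-forms $T$ write $L_\xi T=\frac{d}{dt}(\phi_t^*T)|_{t=0}$, and let the logarithmic rate of volumetric expansion $\operatorname{div}_\omega\xi$ be the function with $L_\xi\omega=(\operatorname{div}_\omega\xi)\,\omega$. Assume that the vector field $(\operatorname{div}_\omega\xi)\,\xi$ has compact support in $M$. Then: 1. The rate of volumetric expansion $L_\xi\omega$ cannot strictly increase or strictly decrease along the flow: neither $L_\xi(L_\xi\omega)>0$ everywhere on $M$ nor $L_\xi(L_\xi\omega)<0$ everywhere on $M$ is possible. 2. If $L_\xi\omega$ is nondecreasing along the flow ($L_\xi(L_\xi\omega)\ge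 0$ everywhere on $M$) or nonincreasing along the flow ($L_\xi(L_\xi\omega)\le 0$ everywhere on $M$), then it is constant along the flow: $L_\xi(L_\xi\omega)=0$ on $M$. 3. If $\operatorname{div}_\omega\xi$ is nondecreasing along the flow ($L_\xi(\operatorname{div}_\omega\xi)\ge 0$ everywhere on $M$), then the flow is incompressible, $\operatorname{div}_\omega\xi=0$ on $M$, and its rate of volumetric expansion vanishes, $L_\xi\omega=0$ on $M$. -/

import Mathlib

open Set Filter
open scoped Manifold Topology ContDiff

noncomputable section

namespace VolumetricExpansion

/-- The tangent space at `x` of a manifold modelled on `ℝⁿ`. -/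
abbrev Tangent (n : ℕ) {M : Type*} [TopologicalSpace M] [ChartedSpace (EuclideanSpace ℝ (Fin n)) M]
    (x : M) : Type :=
  TangentSpace (𝓡 n) x

/-- Vector fields on an `n`-dimensional manifold (no regularity built in). -/
abbrev VField (n : ℕ) (M : Type*) [TopologicalSpace M]
    [ChartedSpace (EuclideanSpace ℝ (Fin n)) M] : Type _ :=
  (x : M) → Tangent n x

/-- Differential `n`-forms on an `n`-dimensional manifold (no regularity built in). -/
abbrev NForm (n : ℕ) (M : Type*) [TopologicalSpace M]
    [ChartedSpace (EuclideanSpace ℝ (Fin n)) M] : Type _ :=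
  (x : M) → Tangent n x [⋀^Fin n]→L[ℝ] ℝ

section

variable {n : ℕ} {M : Type*} [TopologicalSpace M] [ChartedSpace (EuclideanSpace ℝ (Fin n)) M]

/-- A vector field is smooth: it is a smooth section of the tangent bundle. -/
def IsSmoothField [IsManifold (𝓡 n) ∞ M] (ξ : VField n M) : Prop :=
  ContMDiff (𝓡 n) ((𝓡 n).prod 𝓘(ℝ, EuclideanSpace ℝ (Fin n))) ∞
    (fun x ↦ (⟨x, ξ x⟩ : TangentBundle (𝓡 n) M))

/-- The expression of an `n`-form in the chart around `x₀`, i.e. its pull-back to (an open subset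
of) `ℝⁿ` under the inverse of the chart. -/
def NForm.inChart (α : NForm n M) (x₀ : M) (y : EuclideanSpace ℝ (Fin n)) :
    EuclideanSpace ℝ (Fin n) [⋀^Fin n]→L[ℝ] ℝ :=
  (α ((extChartAt (𝓡 n) x₀).symm y)).compContinuousLinearMap
    (mfderiv (𝓡 n) (𝓡 n) (extChartAt (𝓡 n) x₀).symm y)

/-- An `n`-form is smooth if all its chart expressions are smooth. -/
def NForm.IsSmooth (α : NForm n M) : Prop :=
  ∀ x₀ : M, ContDiffOn ℝ ∞ (α.inChart x₀) (extChartAt (𝓡 n) x₀).target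

/-- A volume element (equivalently an `SL(n, ℝ)`-structure): a smooth nowhere vanishing `n`-form. -/
structure IsVolumeElement (vol : NForm n M) : Prop where
  smooth : NForm.IsSmooth vol
  ne_zero : ∀ x, vol x ≠ 0

/-- `φ` is a (local) flow with velocity field `ξ`: near every point and for small times the maps
`φ t` are defined and depend smoothly on time and point, `φ 0` is the identity, and
`t ↦ φ t y` is a trajectory of `ξ`. The values `φ t x` for large `t` are irrelevant.
(For a smooth `ξ` the local group law `φ (s + t) = φ s ∘ φ t` follows from uniqueness of
trajectories.) -/
structure IsFlow (φ : ℝ → M → M) (ξ : VField n M) : Prop where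
  zero : ∀ x, φ 0 x = x
  exists_local : ∀ x : M, ∃ U : Set M, IsOpen U ∧ x ∈ U ∧ ∃ ε : ℝ, 0 < ε ∧
    ContMDiffOn (𝓘(ℝ, ℝ).prod (𝓡 n)) (𝓡 n) ∞ (fun p : ℝ × M ↦ φ p.1 p.2) (Ioo (-ε) ε ×ˢ U) ∧
    ∀ y ∈ U, IsMIntegralCurveOn (I := 𝓡 n) (fun t ↦ φ t y) ξ (Ioo (-ε) ε)

/-- The pull-back `f^* α` of an `n`-form under a map `f : M → M`. -/
def pullback (f : M → M) (α : NForm n M) : NForm n M := fun x ↦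
  (α (f x)).compContinuousLinearMap (mfderiv (𝓡 n) (𝓡 n) f x)

/-- The Lie derivative of an `n`-form along a flow: `L α = d/dt (φ_t^* α)` at `t = 0`. -/
def lieDeriv (φ : ℝ → M → M) (α : NForm n M) : NForm n M := fun x ↦
  deriv (fun t ↦ pullback (φ t) α x) 0

/-- The Lie derivative of a function along a flow: `L f = d/dt (f ∘ φ_t)` at `t = 0`. -/
def lieDerivFun (φ : ℝ → M → M) (f : M → ℝ) : M → ℝ := fun x ↦
  deriv (fun t ↦ f (φ t x)) 0

/-- The logarithmic rate of volumetric expansion (divergence) of a flow with respect to `vol`, i.e.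
the function with `L vol = div · vol`; it is obtained by evaluating both sides on a frame. -/
def divergence (vol : NForm n M) (φ : ℝ → M → M) (x : M) : ℝ :=
  let b : Fin n → Tangent n x := fun i ↦ (EuclideanSpace.basisFun (Fin n) ℝ).toBasis i
  lieDeriv φ vol x b / vol x b

/-- The defining property of the divergence. -/
theorem lieDeriv_eq_divergence_smul (vol : NForm n M) (hvol : ∀ x, vol x ≠ 0) (φ : ℝ → M → M) (x : M) :
    lieDeriv φ vol x = divergence vol φ x • vol x := by
  let b := (EuclideanSpace.basisFun (Fin n) ℝ).toBasis
  have key : ∀ α : EuclideanSpace ℝ (Fin n) [⋀^Fin n]→L[ℝ] ℝ,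
      α.toAlternatingMap = α b • b.det := fun α ↦ α.toAlternatingMap.eq_smul_basis_det b
  have hne : vol x b ≠ 0 := by
    intro h
    apply hvol x
    apply ContinuousAlternatingMap.toAlternatingMap_injective
    refine (key (vol x)).trans ?_
    erw [h, zero_smul]
    rfl
  apply ContinuousAlternatingMap.toAlternatingMap_injective
  refine (key (lieDeriv φ vol x)).trans (Eq.trans ?_ (key (divergence vol φ x • vol x)).symm)
  congr 1
  exact (div_mul_cancel₀ (lieDeriv φ vol x b) hne).symm

/-- The vector field `ξ` has compact support. -/
def HasCompactSupportField (ξ : VField n M) : Prop :=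
  IsCompact (closure {x | ξ x ≠ 0})

/-- `α > 0` at every point, with respect to the orientation given by `vol`. -/
def IsPos (vol α : NForm n M) : Prop :=
  ∀ (x : M) (v : Fin n → Tangent n x), 0 < vol x v → 0 < α x v

/-- `α ≥ 0` at every point, with respect to the orientation given by `vol`. -/
def IsNonneg (vol α : NForm n M) : Prop :=
  ∀ (x : M) (v : Fin n → Tangent n x), 0 < vol x v → 0 ≤ α x v

end

end VolumetricExpansion

end

/-!
Write `f = div ξ`. In a chart an `n`-form is `a dy₁ ∧ … ∧ dyₙ` for a function `a`, its density, and
`L (a dy₁ ∧ … ∧ dyₙ) = div (a ξ) dy₁ ∧ … ∧ dyₙ` (`IsFlow.chartDensity_lieDeriv`): differentiate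
`φ_t^* α`, using that the derivative of the determinant at the identity is the trace and that the
time derivative of the Jacobian of the flow is the derivative of `ξ`. Applied to `vol` and then to
`L vol = f vol` this gives `L (L vol) = h vol`, where `h` is the divergence with respect to `vol` of
the compactly supported field `f ξ`, and `h = L f + f²` (`IsFlow.expansionRate_eq`).

By the divergence theorem `h` has integral zero against `|vol|`, so that it vanishes as soon as it
has constant sign (`IsFlow.expansionRate_eq_zero_of_sign`). This is the claim on `L (L vol)`; and if
`L f ≥ 0`, then `h ≥ f² ≥ 0`, so `h = 0` and `f = 0`.

No measure on `M` is constructed. Instead, functions supported in a chart are integrated there, and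
`h` is cut off by a smooth partition of unity `ρ`. In one chart,
`∫ ρ j h = - ∫ f L(ρ j)` (`IsFlow.chartIntegral_cutoff`), by the divergence theorem on `ℝⁿ`. Since
integrals over different charts agree for functions supported in both (`chartIntegral_eq`), the
right-hand sides can be summed, and `∑ j, L(ρ j) = L 1 = 0` (`IsFlow.sum_chartIntegral_eq_zero`).
-/

noncomputable section

namespace VolumetricExpansion

open MeasureTheory

/-! ### Calculus of vector fields on `ℝⁿ` -/

section Euclidean

/-- The standard frame of `ℝⁿ`, on which forms are evaluated to obtain their densities. -/
def stdFrame (n : ℕ) : Fin n → EuclideanSpace ℝ (Fin n) :=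
  fun i ↦ (EuclideanSpace.basisFun (Fin n) ℝ).toBasis i

/-- The determinant of `n` vectors of `ℝⁿ`, as a continuous alternating map. -/
def stdDet (n : ℕ) : EuclideanSpace ℝ (Fin n) [⋀^Fin n]→L[ℝ] ℝ where
  __ := (EuclideanSpace.basisFun (Fin n) ℝ).toBasis.det
  cont := by
    change Continuous fun v : Fin n → EuclideanSpace ℝ (Fin n) ↦
      (EuclideanSpace.basisFun (Fin n) ℝ).toBasis.det v
    simp only [Module.Basis.det_apply]
    refine Continuous.matrix_det (continuous_matrix fun i j ↦ ?_)
    simp only [Module.Basis.toMatrix_apply, OrthonormalBasis.coe_toBasis_repr_apply,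
      EuclideanSpace.basisFun_repr]
    fun_prop

/-- The divergence of a vector field on `ℝⁿ`. -/
def euclDiv {n : ℕ} (V : EuclideanSpace ℝ (Fin n) → EuclideanSpace ℝ (Fin n))
    (y : EuclideanSpace ℝ (Fin n)) : ℝ :=
  ∑ i, fderiv ℝ V y (stdFrame n i) i

variable {n : ℕ}

lemma eq_sum_smul_stdFrame (v : EuclideanSpace ℝ (Fin n)) : v = ∑ j, v j • stdFrame n j := by
  conv_lhs => rw [← (EuclideanSpace.basisFun (Fin n) ℝ).sum_repr v]
  simp [stdFrame]

lemma stdDet_apply (v : Fin n → EuclideanSpace ℝ (Fin n)) :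
    stdDet n v = (EuclideanSpace.basisFun (Fin n) ℝ).toBasis.det v := rfl

lemma stdDet_stdFrame : stdDet n (stdFrame n) = 1 := by
  rw [stdDet_apply]
  exact (EuclideanSpace.basisFun (Fin n) ℝ).toBasis.det_self

lemma stdDet_map (A : EuclideanSpace ℝ (Fin n) →L[ℝ] EuclideanSpace ℝ (Fin n)) :
    stdDet n (fun i ↦ A (stdFrame n i)) = A.det := by
  rw [stdDet_apply]
  have := (EuclideanSpace.basisFun (Fin n) ℝ).toBasis.det_comp (A : _ →ₗ[ℝ] _) (stdFrame n)
  rw [← stdDet_apply, ← stdDet_apply, stdDet_stdFrame, mul_one] at this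
  exact this

/-- Alternating `n`-forms on `ℝⁿ` are multiples of the determinant. -/
lemma alternating_apply_eq (α : EuclideanSpace ℝ (Fin n) [⋀^Fin n]→L[ℝ] ℝ)
    (v : Fin n → EuclideanSpace ℝ (Fin n)) : α v = α (stdFrame n) * stdDet n v := by
  have := congrArg (fun β ↦ β v)
    (α.toAlternatingMap.eq_smul_basis_det (EuclideanSpace.basisFun (Fin n) ℝ).toBasis)
  exact this

lemma stdDet_update (i : Fin n) (v : EuclideanSpace ℝ (Fin n)) :
    stdDet n (Function.update (stdFrame n) i v) = v i := by
  conv_lhs => rw [eq_sum_smul_stdFrame v]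
  change (stdDet n).toMultilinearMap _ = _
  rw [MultilinearMap.map_update_sum, Finset.sum_eq_single i]
  · rw [MultilinearMap.map_update_smul, Function.update_eq_self]
    change v i • stdDet n (stdFrame n) = _
    simp [stdDet_stdFrame]
  · intro j _ hj
    rw [MultilinearMap.map_update_smul]
    have : (stdDet n).toMultilinearMap (Function.update (stdFrame n) i (stdFrame n j)) = 0 :=
      ((EuclideanSpace.basisFun (Fin n) ℝ).toBasis.det).map_update_self (stdFrame n) hj.symm
    rw [this, smul_zero]
  · simp

/-- The derivative of the determinant at the identity is the trace. -/
lemma hasDerivAt_stdDet {A : ℝ → Fin n → EuclideanSpace ℝ (Fin n)}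
    {A' : Fin n → EuclideanSpace ℝ (Fin n)} {t : ℝ} (hA : ∀ i, HasDerivAt (fun s ↦ A s i) (A' i) t)
    (h0 : A t = stdFrame n) : HasDerivAt (fun s ↦ stdDet n (A s)) (∑ i, A' i i) t := by
  have := (HasFDerivAt.multilinear_comp (f := (stdDet n).toContinuousMultilinearMap)
    (fun i ↦ (hA i).hasFDerivAt)).hasDerivAt
  refine this.congr_deriv ?_
  rw [sum_apply, h0]
  simp only [ContinuousLinearMap.comp_apply, ContinuousLinearMap.toSpanSingleton_apply, one_smul]
  exact Finset.sum_congr rfl fun i _ ↦ stdDet_update i _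

lemma euclDiv_smul {g : EuclideanSpace ℝ (Fin n) → ℝ}
    {V : EuclideanSpace ℝ (Fin n) → EuclideanSpace ℝ (Fin n)} {y : EuclideanSpace ℝ (Fin n)}
    (hg : DifferentiableAt ℝ g y) (hV : DifferentiableAt ℝ V y) :
    euclDiv (fun z ↦ g z • V z) y = fderiv ℝ g y (V y) + g y * euclDiv V y := by
  unfold euclDiv
  rw [fderiv_fun_smul hg hV, Finset.mul_sum]
  -- Only the vector `V y` in the term `fderiv ℝ g y (V y)` is to be expanded in the frame.
  conv_rhs => rw [eq_sum_smul_stdFrame (V y), map_sum]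
  rw [← Finset.sum_add_distrib]
  refine Finset.sum_congr rfl fun i _ ↦ ?_
  simp
  ring

lemma euclDiv_congr {V W : EuclideanSpace ℝ (Fin n) → EuclideanSpace ℝ (Fin n)}
    {y : EuclideanSpace ℝ (Fin n)} (h : V =ᶠ[𝓝 y] W) : euclDiv V y = euclDiv W y := by
  unfold euclDiv
  rw [h.fderiv_eq]

lemma euclDiv_eq_zero {V : EuclideanSpace ℝ (Fin n) → EuclideanSpace ℝ (Fin n)}
    {y : EuclideanSpace ℝ (Fin n)} (h : ∀ᶠ z in 𝓝 y, V z = 0) : euclDiv V y = 0 := by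
  rw [euclDiv_congr (W := fun _ ↦ 0) h]
  simp [euclDiv]

lemma contDiffOn_euclDiv {V : EuclideanSpace ℝ (Fin n) → EuclideanSpace ℝ (Fin n)}
    {T : Set (EuclideanSpace ℝ (Fin n))} (hT : IsOpen T) (hV : ContDiffOn ℝ ∞ V T) :
    ContDiffOn ℝ ∞ (euclDiv V) T := by
  unfold euclDiv
  refine ContDiffOn.sum fun i _ ↦ ?_
  have h1 : ContDiffOn ℝ ∞ (fun y ↦ fderiv ℝ V y (stdFrame n i)) T :=
    (hV.fderiv_of_isOpen hT (by simp)).clm_apply contDiffOn_const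
  exact (EuclideanSpace.proj (𝕜 := ℝ) i).contDiff.comp_contDiffOn h1

/-- The time derivative of the space derivative of `F (t, z)` is the space derivative of its time
derivative, by the symmetry of the second derivative of `F`. -/
lemma hasDerivAt_fderiv_slice {E G : Type*} [NormedAddCommGroup E] [NormedSpace ℝ E]
    [NormedAddCommGroup G] [NormedSpace ℝ G] {F : ℝ × E → G} {t₀ : ℝ} {y : E}
    (hF : ContDiffAt ℝ 2 F (t₀, y)) (v : E) :
    HasDerivAt (fun t ↦ fderiv ℝ (fun z ↦ F (t, z)) y v)
      (fderiv ℝ (fun z ↦ fderiv ℝ F (t₀, z) (1, 0)) y v) t₀ := by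
  have hF' : DifferentiableAt ℝ (fderiv ℝ F) (t₀, y) :=
    (hF.fderiv_right (m := 1) (by norm_num)).differentiableAt one_ne_zero
  have h2 : HasDerivAt (fun t : ℝ ↦ (t, y)) ((1 : ℝ), (0 : E)) t₀ :=
    (hasDerivAt_id _).prodMk (hasDerivAt_const _ _)
  have h3 : ∀ t : ℝ, HasFDerivAt (fun w : E ↦ (t, w)) (ContinuousLinearMap.inr ℝ ℝ E) y :=
    fun t ↦ hasFDerivAt_prodMk_right t y
  have h4 : HasDerivAt (fun t ↦ fderiv ℝ F (t, y) (0, v))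
      (fderiv ℝ (fderiv ℝ F) (t₀, y) (1, 0) (0, v)) t₀ := by
    have h : HasDerivAt (fun t ↦ fderiv ℝ F (t, y)) (fderiv ℝ (fderiv ℝ F) (t₀, y) (1, 0)) t₀ :=
      hF'.hasFDerivAt.comp_hasDerivAt t₀ h2
    exact (ContinuousLinearMap.apply ℝ G ((0 : ℝ), v)).hasFDerivAt.comp_hasDerivAt t₀ h
  have h5 : fderiv ℝ (fun z ↦ fderiv ℝ F (t₀, z) (1, 0)) y v =
      fderiv ℝ (fderiv ℝ F) (t₀, y) (0, v) (1, 0) := by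
    have h : HasFDerivAt (fun z ↦ fderiv ℝ F (t₀, z))
        ((fderiv ℝ (fderiv ℝ F) (t₀, y)).comp (ContinuousLinearMap.inr ℝ ℝ E)) y :=
      hF'.hasFDerivAt.comp y (h3 t₀)
    have := ((ContinuousLinearMap.apply ℝ G ((1 : ℝ), (0 : E))).hasFDerivAt.comp y h).fderiv
    change fderiv ℝ (ContinuousLinearMap.apply ℝ G ((1 : ℝ), (0 : E)) ∘
      fun z ↦ fderiv ℝ F (t₀, z)) y v = _
    rw [this]
    simp
  have hs : IsSymmSndFDerivAt ℝ F (t₀, y) := hF.isSymmSndFDerivAt (by simp)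
  rw [h5, hs.eq]
  refine h4.congr_of_eventuallyEq ?_
  have hd : ∀ᶠ p in 𝓝 (t₀, y), DifferentiableAt ℝ F p := by
    filter_upwards [(hF.of_le (m := 1) (by norm_num)).eventually (by simp)] with p hp
      using hp.differentiableAt one_ne_zero
  filter_upwards [h2.continuousAt.eventually hd] with t ht
  have := (ht.hasFDerivAt.comp y (h3 t)).fderiv
  simp only [Function.comp_def] at this
  rw [this]
  simp

/-- The divergence theorem for compactly supported fields on `ℝⁿ`. -/
lemma integral_euclDiv_eq_zero {V : EuclideanSpace ℝ (Fin n) → EuclideanSpace ℝ (Fin n)}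
    (hV : ContDiff ℝ 1 V) (hc : HasCompactSupport V) : ∫ y, euclDiv V y = 0 := by
  have hd : ∀ i, Integrable fun y ↦ fderiv ℝ V y (stdFrame n i) i := by
    intro i
    refine Continuous.integrable_of_hasCompactSupport ?_ ?_
    · have := hV.continuous_fderiv one_ne_zero
      fun_prop
    · refine (hc.fderiv ℝ).mono fun y hy ↦ ?_
      contrapose! hy
      simp_all
  unfold euclDiv
  rw [integral_finsetSum _ fun i _ ↦ hd i]
  refine Finset.sum_eq_zero fun i _ ↦ ?_
  have hVi : Differentiable ℝ fun y ↦ V y i := by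
    have := hV.differentiable one_ne_zero
    fun_prop
  have hi : Integrable fun y ↦ V y i := by
    refine Continuous.integrable_of_hasCompactSupport ?_ ?_
    · have := hV.continuous
      fun_prop
    · refine hc.mono fun y hy ↦ ?_
      contrapose! hy
      simp_all
  have hf : ∀ y, fderiv ℝ (fun y ↦ V y i) y (stdFrame n i) = fderiv ℝ V y (stdFrame n i) i := by
    intro y
    have h1 := (hV.differentiable one_ne_zero y).hasFDerivAt
    have h2 := ((EuclideanSpace.proj (𝕜 := ℝ) i).hasFDerivAt.comp y h1).fderiv
    simp only [Function.comp_def, PiLp.proj_apply] at h2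
    rw [h2]
    rfl
  -- Integration by parts against the constant function `1`.
  have := integral_mul_fderiv_eq_neg_fderiv_mul_of_integrable (𝕜 := ℝ) (μ := volume)
    (f := fun _ : EuclideanSpace ℝ (Fin n) ↦ (1 : ℝ)) (g := fun y ↦ V y i) (v := stdFrame n i)
    (by simp) (by simpa only [hf, one_mul] using hd i) (by simpa using hi)
    (fun _ _ ↦ differentiableAt_const _) (fun _ _ ↦ hVi _)
  simpa [hf] using this

/-- The divergence theorem on an open set `T` for a field with compact support in `T`. The values of
the field off `T` do not matter, since it can be replaced by its extension by zero. -/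
lemma setIntegral_euclDiv_eq_zero {V : EuclideanSpace ℝ (Fin n) → EuclideanSpace ℝ (Fin n)}
    {T C : Set (EuclideanSpace ℝ (Fin n))} (hT : IsOpen T) (hV : ContDiffOn ℝ 1 V T)
    (hC : IsCompact C) (hCT : C ⊆ T) (h0 : ∀ y ∈ T \ C, V y = 0) : ∫ y in T, euclDiv V y = 0 := by
  have hz : ∀ y ∉ C, T.indicator V y = 0 := fun y hy ↦ by
    by_cases hyT : y ∈ T
    · rw [indicator_of_mem hyT, h0 y ⟨hyT, hy⟩]
    · exact indicator_of_notMem hyT _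
  have hW : ContDiff ℝ 1 (T.indicator V) := by
    refine contDiff_iff_contDiffAt.2 fun y ↦ ?_
    by_cases hy : y ∈ C
    · refine (hV.contDiffAt (hT.mem_nhds (hCT hy))).congr_of_eventuallyEq ?_
      filter_upwards [hT.mem_nhds (hCT hy)] with z hz using indicator_of_mem hz _
    · refine (contDiffAt_const (c := 0)).congr_of_eventuallyEq ?_
      filter_upwards [hC.isClosed.isOpen_compl.mem_nhds hy] with z using hz z
  rw [← integral_euclDiv_eq_zero hW (HasCompactSupport.intro hC hz),
    ← setIntegral_eq_integral_of_forall_compl_eq_zero (s := T) (f := euclDiv (T.indicator V))]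
  · refine setIntegral_congr_fun hT.measurableSet fun y hy ↦ euclDiv_congr ?_
    filter_upwards [hT.mem_nhds hy] with z hz using (indicator_of_mem hz _).symm
  · intro y hy
    refine euclDiv_eq_zero ?_
    filter_upwards [hC.isClosed.isOpen_compl.mem_nhds fun h ↦ hy (hCT h)] with z using hz z

end Euclidean

/-! ### The flow and `n`-forms in a chart -/

section Charts

variable {n : ℕ} {M : Type*} [TopologicalSpace M] [ChartedSpace (EuclideanSpace ℝ (Fin n)) M]

/-- The density of an `n`-form in the chart around `c` with respect to the standard volume form. -/
def chartDensity (α : NForm n M) (c : M) (y : EuclideanSpace ℝ (Fin n)) : ℝ :=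
  α.inChart c y (stdFrame n)

/-- The flow read in the chart around `c`, as a function of time and point. It is
meaningful for points in the target of the chart and small times. -/
def chartFlow (n : ℕ) {M : Type*} [TopologicalSpace M] [ChartedSpace (EuclideanSpace ℝ (Fin n)) M]
    (φ : ℝ → M → M) (c : M) (p : ℝ × EuclideanSpace ℝ (Fin n)) :
    EuclideanSpace ℝ (Fin n) :=
  extChartAt (𝓡 n) c (φ p.1 ((extChartAt (𝓡 n) c).symm p.2))

/-- The velocity at time `0` of the flow read in the chart around `c`, i.e. the chart expression of
`ξ`. It is defined by the partial derivative of the flow, which makes its smoothness a consequence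
of that of the flow. -/
def chartField (n : ℕ) {M : Type*} [TopologicalSpace M] [ChartedSpace (EuclideanSpace ℝ (Fin n)) M]
    (φ : ℝ → M → M) (c : M) (y : EuclideanSpace ℝ (Fin n)) :
    EuclideanSpace ℝ (Fin n) :=
  fderiv ℝ (chartFlow n φ c) (0, y) (1, 0)

lemma inChart_apply_eq (α : NForm n M) (c : M) (y : EuclideanSpace ℝ (Fin n))
    (v : Fin n → EuclideanSpace ℝ (Fin n)) :
    α.inChart c y v = chartDensity α c y * stdDet n v :=
  alternating_apply_eq _ v

/-- All tangent spaces are the same type `ℝⁿ`, so that forms at propositionally equal points can be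
compared on the same vectors. -/
lemma apply_congr_point (α : NForm n M) {x x' : M} (h : x = x')
    (v : Fin n → EuclideanSpace ℝ (Fin n)) : α x v = α x' v := by
  subst h
  rfl

variable {φ : ℝ → M → M} {ξ : VField n M} {α : NForm n M} {c : M}
  {y : EuclideanSpace ℝ (Fin n)}

lemma NForm.IsSmooth.contDiffOn_chartDensity (hα : NForm.IsSmooth α) (c : M) :
    ContDiffOn ℝ ∞ (chartDensity α c) (extChartAt (𝓡 n) c).target :=
  (ContinuousAlternatingMap.apply ℝ (EuclideanSpace ℝ (Fin n)) ℝ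
    (stdFrame n)).contDiff.comp_contDiffOn (hα c)

lemma IsFlow.contMDiffAt (hφ : IsFlow φ ξ) (x : M) :
    ContMDiffAt (𝓘(ℝ, ℝ).prod (𝓡 n)) (𝓡 n) ∞ (fun p : ℝ × M ↦ φ p.1 p.2) (0, x) := by
  obtain ⟨U, hU, hx, ε, hε, h, -⟩ := hφ.exists_local x
  exact h.contMDiffAt ((isOpen_Ioo.prod hU).mem_nhds ⟨⟨by simpa using hε, hε⟩, hx⟩)

lemma IsFlow.eventually_mdifferentiableAt (hφ : IsFlow φ ξ) (x : M) :
    ∀ᶠ t in 𝓝 (0 : ℝ), MDifferentiableAt (𝓡 n) (𝓡 n) (φ t) x := by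
  obtain ⟨U, hU, hx, ε, hε, h, -⟩ := hφ.exists_local x
  filter_upwards [Ioo_mem_nhds (neg_lt_zero.2 hε) hε] with t ht
  have h1 := h.contMDiffAt ((isOpen_Ioo.prod hU).mem_nhds (mk_mem_prod ht hx))
  exact (h1.comp x (contMDiffAt_const.prodMk contMDiffAt_id)).mdifferentiableAt (by simp)

lemma IsFlow.chartFlow_zero (hφ : IsFlow φ ξ) (hy : y ∈ (extChartAt (𝓡 n) c).target) :
    chartFlow n φ c (0, y) = y := by
  simp only [chartFlow, hφ.zero]
  exact (extChartAt (𝓡 n) c).right_inv hy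

variable [IsManifold (𝓡 n) ∞ M]

lemma contMDiffAt_chart_symm (hy : y ∈ (extChartAt (𝓡 n) c).target) :
    ContMDiffAt (𝓡 n) (𝓡 n) ∞ (extChartAt (𝓡 n) c).symm y :=
  (contMDiffOn_extChartAt_symm c).contMDiffAt ((isOpen_extChartAt_target c).mem_nhds hy)

lemma mdifferentiableAt_chart_symm (hy : y ∈ (extChartAt (𝓡 n) c).target) :
    MDifferentiableAt (𝓡 n) (𝓡 n) (extChartAt (𝓡 n) c).symm y :=
  (contMDiffAt_chart_symm hy).mdifferentiableAt (by simp)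

lemma IsFlow.contMDiffAt_comp_symm (hφ : IsFlow φ ξ) (hy : y ∈ (extChartAt (𝓡 n) c).target) :
    ContMDiffAt 𝓘(ℝ, ℝ × EuclideanSpace ℝ (Fin n)) (𝓡 n) ∞
      (fun p : ℝ × EuclideanSpace ℝ (Fin n) ↦ φ p.1 ((extChartAt (𝓡 n) c).symm p.2)) (0, y) := by
  have h1 := hφ.contMDiffAt ((extChartAt (𝓡 n) c).symm y)
  have h2 : ContMDiffAt 𝓘(ℝ, ℝ × EuclideanSpace ℝ (Fin n)) (𝓘(ℝ, ℝ).prod (𝓡 n)) ∞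
      (fun p : ℝ × EuclideanSpace ℝ (Fin n) ↦ (p.1, (extChartAt (𝓡 n) c).symm p.2)) (0, y) :=
    contDiff_fst.contMDiff.contMDiffAt.prodMk
      ((contMDiffAt_chart_symm hy).comp (0, y) contDiff_snd.contMDiff.contMDiffAt)
  exact ContMDiffAt.comp (0, y) h1 h2

lemma IsFlow.contDiffAt_chartFlow (hφ : IsFlow φ ξ) (hy : y ∈ (extChartAt (𝓡 n) c).target) :
    ContDiffAt ℝ ∞ (chartFlow n φ c) (0, y) := by
  refine contMDiffAt_iff_contDiffAt.1 ?_
  refine ContMDiffAt.comp (0, y) ?_ (hφ.contMDiffAt_comp_symm hy)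
  refine contMDiffAt_extChartAt' ?_
  rw [hφ.zero, ← extChartAt_source (𝓡 n)]
  exact (extChartAt (𝓡 n) c).map_target hy

lemma IsFlow.eventually_mem_source (hφ : IsFlow φ ξ) (hy : y ∈ (extChartAt (𝓡 n) c).target) :
    ∀ᶠ p in 𝓝 ((0 : ℝ), y),
      φ p.1 ((extChartAt (𝓡 n) c).symm p.2) ∈ (extChartAt (𝓡 n) c).source := by
  refine (hφ.contMDiffAt_comp_symm hy).continuousAt.eventually_mem ?_
  refine (isOpen_extChartAt_source c).mem_nhds ?_
  rw [hφ.zero]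
  exact (extChartAt (𝓡 n) c).map_target hy

lemma IsFlow.contDiffOn_chartField (hφ : IsFlow φ ξ) (c : M) :
    ContDiffOn ℝ ∞ (chartField n φ c) (extChartAt (𝓡 n) c).target := fun y hy ↦ by
  have h1 : ContDiffAt ℝ ∞ (fderiv ℝ (chartFlow n φ c)) (0, y) :=
    (hφ.contDiffAt_chartFlow hy).fderiv_right (by simp)
  have h2 : ContDiffAt ℝ ∞ (fun z : EuclideanSpace ℝ (Fin n) ↦ ((0 : ℝ), z)) y := by fun_prop
  exact ((h1.comp y h2).clm_apply contDiffAt_const).contDiffWithinAt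

lemma IsFlow.hasDerivAt_chartFlow (hφ : IsFlow φ ξ) (hy : y ∈ (extChartAt (𝓡 n) c).target) :
    HasDerivAt (fun t ↦ chartFlow n φ c (t, y)) (chartField n φ c y) 0 := by
  have h1 := ((hφ.contDiffAt_chartFlow hy).differentiableAt (by simp)).hasFDerivAt
  have h2 : HasDerivAt (fun t : ℝ ↦ (t, y)) ((1 : ℝ), (0 : EuclideanSpace ℝ (Fin n))) 0 :=
    (hasDerivAt_id _).prodMk (hasDerivAt_const _ _)
  exact h1.comp_hasDerivAt (0 : ℝ) h2

/-- The time derivative of the Jacobian of the flow is the derivative of the velocity field. -/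
lemma IsFlow.hasDerivAt_fderiv_chartFlow (hφ : IsFlow φ ξ)
    (hy : y ∈ (extChartAt (𝓡 n) c).target) (v : EuclideanSpace ℝ (Fin n)) :
    HasDerivAt (fun t ↦ fderiv ℝ (fun z ↦ chartFlow n φ c (t, z)) y v)
      (fderiv ℝ (chartField n φ c) y v) 0 :=
  hasDerivAt_fderiv_slice ((hφ.contDiffAt_chartFlow hy).of_le (by norm_cast)) v

/-- For small `t`, the chart expression of `φ_t^* α` at `y` is the pull-back of the chart expression
of `α` under the flow read in the chart. -/
lemma IsFlow.eventually_pullback_apply (hφ : IsFlow φ ξ) (α : NForm n M)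
    (hy : y ∈ (extChartAt (𝓡 n) c).target) :
    ∀ᶠ t in 𝓝 (0 : ℝ), ∀ v : Fin n → EuclideanSpace ℝ (Fin n),
      pullback (φ t) α ((extChartAt (𝓡 n) c).symm y)
        (fun i ↦ mfderiv (𝓡 n) (𝓡 n) (extChartAt (𝓡 n) c).symm y (v i)) =
      α.inChart c (chartFlow n φ c (t, y))
        (fun i ↦ fderiv ℝ (fun z ↦ chartFlow n φ c (t, z)) y (v i)) := by
  have hc : ContinuousAt (fun t : ℝ ↦ (t, y)) 0 := by fun_prop
  have hev : ∀ᶠ p in 𝓝 ((0 : ℝ), y), DifferentiableAt ℝ (chartFlow n φ c) p ∧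
      ∀ᶠ q in 𝓝 p, φ q.1 ((extChartAt (𝓡 n) c).symm q.2) ∈ (extChartAt (𝓡 n) c).source := by
    filter_upwards [(hφ.eventually_mem_source hy).eventually_nhds,
      ((hφ.contDiffAt_chartFlow hy).of_le (m := 1) (by norm_cast)).eventually (by simp)]
      with p hp hp' using ⟨hp'.differentiableAt one_ne_zero, hp⟩
  filter_upwards [hc.eventually hev, hφ.eventually_mdifferentiableAt ((extChartAt (𝓡 n) c).symm y)]
    with t ht htd v
  obtain ⟨hd, ht⟩ := ht
  set ψ := extChartAt (𝓡 n) c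
  have hsrc : φ t (ψ.symm y) ∈ ψ.source := ht.self_of_nhds
  have hy' : chartFlow n φ c (t, y) ∈ ψ.target := ψ.map_source hsrc
  have hdt : DifferentiableAt ℝ (fun z ↦ chartFlow n φ c (t, z)) y := by
    have : DifferentiableAt ℝ (fun z : EuclideanSpace ℝ (Fin n) ↦ (t, z)) y := by fun_prop
    exact hd.comp y this
  have h1 : mfderiv (𝓡 n) (𝓡 n) (φ t ∘ ψ.symm) y =
      (mfderiv (𝓡 n) (𝓡 n) (φ t) (ψ.symm y)).comp (mfderiv (𝓡 n) (𝓡 n) ψ.symm y) :=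
    mfderiv_comp y htd (mdifferentiableAt_chart_symm hy)
  have h2 : mfderiv (𝓡 n) (𝓡 n) (ψ.symm ∘ fun z ↦ chartFlow n φ c (t, z)) y =
      (mfderiv (𝓡 n) (𝓡 n) ψ.symm (chartFlow n φ c (t, y))).comp
        (mfderiv (𝓡 n) (𝓡 n) (fun z ↦ chartFlow n φ c (t, z)) y) :=
    mfderiv_comp y (mdifferentiableAt_chart_symm hy') hdt.mdifferentiableAt
  have h3 : φ t ∘ ψ.symm =ᶠ[𝓝 y] ψ.symm ∘ fun z ↦ chartFlow n φ c (t, z) := by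
    have hc' : ContinuousAt (fun z : EuclideanSpace ℝ (Fin n) ↦ (t, z)) y := by fun_prop
    filter_upwards [hc'.eventually ht] with z hz
    exact (ψ.left_inv hz).symm
  have h4 := h3.mfderiv_eq (I := 𝓡 n) (I' := 𝓡 n)
  rw [mfderiv_eq_fderiv] at h2
  have h5 : ∀ w : EuclideanSpace ℝ (Fin n),
      mfderiv (𝓡 n) (𝓡 n) (φ t) (ψ.symm y) (mfderiv (𝓡 n) (𝓡 n) ψ.symm y w) =
      mfderiv (𝓡 n) (𝓡 n) ψ.symm (chartFlow n φ c (t, y))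
        (fderiv ℝ (fun z ↦ chartFlow n φ c (t, z)) y w) := by
    intro w
    have := congrArg (fun A : EuclideanSpace ℝ (Fin n) →L[ℝ] EuclideanSpace ℝ (Fin n) ↦ A w)
      (h1.symm.trans (h4.trans h2))
    exact this
  have h6 := apply_congr_point α (ψ.left_inv hsrc).symm
    (fun i ↦ mfderiv (𝓡 n) (𝓡 n) (φ t) (ψ.symm y) (mfderiv (𝓡 n) (𝓡 n) ψ.symm y (v i)))
  refine h6.trans ?_
  simp only [h5]
  rfl

end Charts

/-! ### The Lie derivative of an `n`-form in a chart -/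

section LieDerivative

variable {n : ℕ} {M : Type*} [TopologicalSpace M] [ChartedSpace (EuclideanSpace ℝ (Fin n)) M]
  [IsManifold (𝓡 n) ∞ M] {φ : ℝ → M → M} {ξ : VField n M} {α vol : NForm n M} {c : M}
  {y : EuclideanSpace ℝ (Fin n)}

lemma isInvertible_mfderiv_chart_symm (hy : y ∈ (extChartAt (𝓡 n) c).target) :
    (mfderiv (𝓡 n) (𝓡 n) (extChartAt (𝓡 n) c).symm y).IsInvertible := by
  have : IsManifold (𝓡 n) 1 M := IsManifold.of_le (n := ∞) (by norm_cast)
  have := isInvertible_mfderivWithin_extChartAt_symm (I := 𝓡 n) hy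
  simpa using this

/-- In a chart, `L (a dy₁ ∧ … ∧ dyₙ) = div (a ξ) dy₁ ∧ … ∧ dyₙ`. -/
theorem IsFlow.chartDensity_lieDeriv (hφ : IsFlow φ ξ) (hy : y ∈ (extChartAt (𝓡 n) c).target)
    (hα : DifferentiableAt ℝ (chartDensity α c) y) :
    chartDensity (lieDeriv φ α) c y =
      euclDiv (fun z ↦ chartDensity α c z • chartField n φ c z) y := by
  have hfield : DifferentiableAt ℝ (chartField n φ c) y :=
    ((hφ.contDiffOn_chartField c).contDiffAt
      ((isOpen_extChartAt_target c).mem_nhds hy)).differentiableAt (by simp)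
  rw [euclDiv_smul hα hfield]
  set a := chartDensity α c
  -- `s t` is the density of `φ_t^* α` at `y`, and `s'` will be its derivative at `t = 0`.
  let s : ℝ → ℝ := fun t ↦ a (chartFlow n φ c (t, y)) *
    stdDet n (fun i ↦ fderiv ℝ (fun z ↦ chartFlow n φ c (t, z)) y (stdFrame n i))
  set s' : ℝ := fderiv ℝ a y (chartField n φ c y) + a y * euclDiv (chartField n φ c) y
  have hid : (fun i ↦ fderiv ℝ (fun z ↦ chartFlow n φ c (0, z)) y (stdFrame n i)) =
      stdFrame n := by
    have : (fun z ↦ chartFlow n φ c (0, z)) =ᶠ[𝓝 y] id := by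
      filter_upwards [(isOpen_extChartAt_target c).mem_nhds hy] with z hz
      exact hφ.chartFlow_zero hz
    rw [this.fderiv_eq, fderiv_id]
    rfl
  have hs : HasDerivAt s s' 0 := by
    have h0 : chartFlow n φ c (0, y) = y := hφ.chartFlow_zero hy
    have h1 : HasDerivAt (fun t ↦ a (chartFlow n φ c (t, y)))
        (fderiv ℝ a y (chartField n φ c y)) 0 :=
      HasFDerivAt.comp_hasDerivAt_of_eq (0 : ℝ) hα.hasFDerivAt (hφ.hasDerivAt_chartFlow hy) h0.symm
    have h2 := hasDerivAt_stdDet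
      (fun i ↦ hφ.hasDerivAt_fderiv_chartFlow hy (stdFrame n i)) hid
    refine (h1.mul h2).congr_deriv ?_
    rw [hid, stdDet_stdFrame, h0, mul_one]
    rfl
  obtain ⟨e, he⟩ := isInvertible_mfderiv_chart_symm hy
  let e' : EuclideanSpace ℝ (Fin n) ≃L[ℝ] EuclideanSpace ℝ (Fin n) := e
  have he' : ∀ v : EuclideanSpace ℝ (Fin n),
      mfderiv (𝓡 n) (𝓡 n) (extChartAt (𝓡 n) c).symm y v = e' v := fun v ↦ by rw [← he]; rfl
  -- As a path of forms on the tangent space, `φ_t^* α` is `s t` times the constant form `C`, the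
  -- standard volume form transported by the chart.
  let C : EuclideanSpace ℝ (Fin n) [⋀^Fin n]→L[ℝ] ℝ :=
    (stdDet n).compContinuousLinearMap (e'.symm : _ →L[ℝ] _)
  let P : ℝ → EuclideanSpace ℝ (Fin n) [⋀^Fin n]→L[ℝ] ℝ :=
    fun t ↦ pullback (φ t) α ((extChartAt (𝓡 n) c).symm y)
  have hP : P =ᶠ[𝓝 0] fun t ↦ s t • C := by
    filter_upwards [hφ.eventually_pullback_apply α hy] with t ht
    have key : ∀ v, P t (fun i ↦ e' (v i)) = s t * stdDet n v := by
      intro v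
      have h1 := ht v
      simp only [he'] at h1
      refine h1.trans ?_
      have h2 : ∀ B : EuclideanSpace ℝ (Fin n) →L[ℝ] EuclideanSpace ℝ (Fin n),
          stdDet n (fun i ↦ B (v i)) = stdDet n (fun i ↦ B (stdFrame n i)) * stdDet n v :=
        fun B ↦ alternating_apply_eq ((stdDet n).compContinuousLinearMap B) v
      rw [inChart_apply_eq, h2, ← mul_assoc]
    ext v
    have := key fun i ↦ e'.symm (v i)
    simp only [ContinuousLinearEquiv.apply_symm_apply] at this
    exact this
  have hd : HasDerivAt P (s' • C) 0 := (hs.smul_const C).congr_of_eventuallyEq hP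
  have hl : lieDeriv φ α ((extChartAt (𝓡 n) c).symm y) = s' • C := hd.deriv
  change lieDeriv φ α ((extChartAt (𝓡 n) c).symm y)
    (fun i ↦ mfderiv (𝓡 n) (𝓡 n) (extChartAt (𝓡 n) c).symm y (stdFrame n i)) = s'
  simp only [he', hl]
  change s' * stdDet n (fun i ↦ e'.symm (e' (stdFrame n i))) = s'
  simp [stdDet_stdFrame]

end LieDerivative

/-! ### Ratios of `n`-forms -/

section Ratio

variable {n : ℕ} {M : Type*} [TopologicalSpace M] [ChartedSpace (EuclideanSpace ℝ (Fin n)) M]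
  {φ : ℝ → M → M} {ξ : VField n M} {α vol : NForm n M} {c : M}
  {y : EuclideanSpace ℝ (Fin n)}

/-- The ratio `α / vol` of two `n`-forms, a function on `M`. Like `divergence` it is computed on the
standard frame of the tangent space, which is immaterial where `vol` does not vanish. -/
def formRatio (vol α : NForm n M) (x : M) : ℝ :=
  let b : Fin n → Tangent n x := fun i ↦ (EuclideanSpace.basisFun (Fin n) ℝ).toBasis i
  α x b / vol x b

lemma divergence_eq_formRatio : divergence vol φ = formRatio vol (lieDeriv φ vol) := rfl

lemma apply_eq_formRatio_mul {x : M} (hvol : vol x ≠ 0) (α : NForm n M) (v : Fin n → Tangent n x) :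
    α x v = formRatio vol α x * vol x v := by
  have key : ∀ (β : NForm n M) (w : Fin n → Tangent n x),
      β x w = β x (stdFrame n) * stdDet n w := fun β w ↦ alternating_apply_eq (β x) w
  have hne : vol x (stdFrame n) ≠ 0 := by
    intro h
    apply hvol
    ext w
    rw [key vol w, h, zero_mul]
    rfl
  have hr : formRatio vol α x = α x (stdFrame n) / vol x (stdFrame n) := rfl
  rw [key α v, key vol v, hr]
  field_simp

lemma chartDensity_eq_formRatio_mul (hvol : ∀ x, vol x ≠ 0) (α : NForm n M) (c : M)
    (y : EuclideanSpace ℝ (Fin n)) :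
    chartDensity α c y =
      formRatio vol α ((extChartAt (𝓡 n) c).symm y) * chartDensity vol c y :=
  apply_eq_formRatio_mul (hvol _) α _

/-- Positivity conditions relative to the orientation given by `vol` are not vacuous. -/
lemma exists_apply_pos (hn : n ≠ 0) {x : M} (hvol : vol x ≠ 0) :
    ∃ v : Fin n → Tangent n x, 0 < vol x v := by
  obtain ⟨v, hv⟩ : ∃ v, vol x v ≠ 0 := by
    by_contra! h
    exact hvol (by ext v; exact h v)
  rcases hv.lt_or_gt with h | h
  · have : NeZero n := ⟨hn⟩
    -- Reversing one vector reverses the orientation; this needs `n ≠ 0`.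
    refine ⟨Function.update v 0 ((-1 : ℝ) • v 0), ?_⟩
    rw [ContinuousAlternatingMap.map_update_smul, Function.update_eq_self]
    simpa using h
  · exact ⟨v, h⟩

/-- Functions that are continuous in all charts are continuous. -/
lemma continuous_of_forall_chart {u : M → ℝ}
    (h : ∀ c : M, ContinuousOn (fun y ↦ u ((extChartAt (𝓡 n) c).symm y))
      (extChartAt (𝓡 n) c).target) : Continuous u := by
  refine continuous_iff_continuousAt.2 fun x ↦ ?_
  have h1 : ContinuousAt ((fun y ↦ u ((extChartAt (𝓡 n) x).symm y)) ∘ extChartAt (𝓡 n) x) x :=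
    ((h x).continuousAt ((isOpen_extChartAt_target x).mem_nhds
      (mem_extChartAt_target x))).comp (continuousAt_extChartAt x)
  refine h1.congr ?_
  filter_upwards [extChartAt_source_mem_nhds (I := 𝓡 n) x] with z hz
  exact congrArg u ((extChartAt (𝓡 n) x).left_inv hz)

variable [IsManifold (𝓡 n) ∞ M]

lemma chartDensity_ne_zero (hvol : ∀ x, vol x ≠ 0) (hy : y ∈ (extChartAt (𝓡 n) c).target) :
    chartDensity vol c y ≠ 0 := by
  intro h
  obtain ⟨e, he⟩ := isInvertible_mfderiv_chart_symm hy
  let e' : EuclideanSpace ℝ (Fin n) ≃L[ℝ] EuclideanSpace ℝ (Fin n) := e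
  have he' : ∀ v : EuclideanSpace ℝ (Fin n),
      mfderiv (𝓡 n) (𝓡 n) (extChartAt (𝓡 n) c).symm y v = e' v := fun v ↦ by rw [← he]; rfl
  apply hvol ((extChartAt (𝓡 n) c).symm y)
  ext v
  have h1 := inChart_apply_eq vol c y fun i ↦ e'.symm (v i)
  rw [h, zero_mul] at h1
  have h2 : vol ((extChartAt (𝓡 n) c).symm y)
      (fun i ↦ mfderiv (𝓡 n) (𝓡 n) (extChartAt (𝓡 n) c).symm y (e'.symm (v i))) = 0 := h1
  simp only [he'] at h2
  have h3 : (fun i ↦ e' (e'.symm (v i))) = v := funext fun i ↦ e'.apply_symm_apply (v i)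
  exact (congrArg (vol ((extChartAt (𝓡 n) c).symm y)) h3).symm.trans h2

lemma IsFlow.contDiffOn_chartDensity_lieDeriv (hφ : IsFlow φ ξ)
    (hα : ContDiffOn ℝ ∞ (chartDensity α c) (extChartAt (𝓡 n) c).target) :
    ContDiffOn ℝ ∞ (chartDensity (lieDeriv φ α) c) (extChartAt (𝓡 n) c).target := by
  have hT := isOpen_extChartAt_target (I := 𝓡 n) c
  refine (contDiffOn_euclDiv hT (hα.smul (hφ.contDiffOn_chartField c))).congr fun y hy ↦ ?_
  exact hφ.chartDensity_lieDeriv hy ((hα.contDiffAt (hT.mem_nhds hy)).differentiableAt (by simp))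

lemma contDiffOn_formRatio (hvol : IsVolumeElement vol)
    (hα : ContDiffOn ℝ ∞ (chartDensity α c) (extChartAt (𝓡 n) c).target) :
    ContDiffOn ℝ ∞ (fun y ↦ formRatio vol α ((extChartAt (𝓡 n) c).symm y))
      (extChartAt (𝓡 n) c).target := by
  refine (hα.div (hvol.smooth.contDiffOn_chartDensity c)
    fun y hy ↦ chartDensity_ne_zero hvol.ne_zero hy).congr fun y hy ↦ ?_
  rw [Pi.div_apply, chartDensity_eq_formRatio_mul hvol.ne_zero α,
    mul_div_cancel_right₀ _ (chartDensity_ne_zero hvol.ne_zero hy)]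

lemma IsFlow.lieDerivFun_chart (hφ : IsFlow φ ξ) {u : M → ℝ}
    (hy : y ∈ (extChartAt (𝓡 n) c).target)
    (hu : DifferentiableAt ℝ (fun z ↦ u ((extChartAt (𝓡 n) c).symm z)) y) :
    lieDerivFun φ u ((extChartAt (𝓡 n) c).symm y) =
      fderiv ℝ (fun z ↦ u ((extChartAt (𝓡 n) c).symm z)) y (chartField n φ c y) := by
  have h1 := HasFDerivAt.comp_hasDerivAt_of_eq (0 : ℝ) hu.hasFDerivAt
    (hφ.hasDerivAt_chartFlow hy) (hφ.chartFlow_zero hy).symm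
  refine HasDerivAt.deriv (h1.congr_of_eventuallyEq ?_)
  have hc : ContinuousAt (fun t : ℝ ↦ (t, y)) 0 := by fun_prop
  filter_upwards [hc.eventually (hφ.eventually_mem_source hy)] with t ht
  simp only [chartFlow, Function.comp_def]
  rw [(extChartAt (𝓡 n) c).left_inv ht]

lemma IsFlow.chartField_eq_zero (hφ : IsFlow φ ξ) (hy : y ∈ (extChartAt (𝓡 n) c).target)
    (h0 : ξ ((extChartAt (𝓡 n) c).symm y) = 0) : chartField n φ c y = 0 := by
  set x := (extChartAt (𝓡 n) c).symm y
  have hx : x ∈ (extChartAt (𝓡 n) c).source := (extChartAt (𝓡 n) c).map_target hy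
  obtain ⟨U, -, hxU, ε, hε, -, hU⟩ := hφ.exists_local x
  have h1 := (hU x hxU 0 ⟨neg_lt_zero.2 hε, hε⟩).hasMFDerivAt
    (Ioo_mem_nhds (neg_lt_zero.2 hε) hε)
  have h0' : ξ (φ 0 x) = 0 := by rw [hφ.zero]; exact h0
  have h2 : MDifferentiableAt (𝓡 n) (𝓡 n) (extChartAt (𝓡 n) c) (φ 0 x) := by
    refine (contMDiffAt_extChartAt' (n := ∞) ?_).mdifferentiableAt (by simp)
    rw [hφ.zero, ← extChartAt_source (𝓡 n)]
    exact hx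
  let D : ℝ →L[ℝ] EuclideanSpace ℝ (Fin n) :=
    (mfderiv (𝓡 n) (𝓡 n) (extChartAt (𝓡 n) c) (φ 0 x)).comp
      ((1 : ℝ →L[ℝ] ℝ).smulRight (ξ (φ 0 x)))
  have h3 : HasFDerivAt (fun t ↦ chartFlow n φ c (t, y)) D 0 :=
    (h2.hasMFDerivAt.comp (0 : ℝ) h1).hasFDerivAt
  refine (hφ.hasDerivAt_chartFlow hy).unique (h3.hasDerivAt.congr_deriv ?_)
  change mfderiv (𝓡 n) (𝓡 n) (extChartAt (𝓡 n) c) (φ 0 x) ((1 : ℝ) • ξ (φ 0 x)) = _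
  rw [h0', smul_zero]
  exact map_zero _

lemma IsFlow.divergence_smul_chartField_eq_zero (hφ : IsFlow φ ξ)
    (hy : y ∈ (extChartAt (𝓡 n) c).target)
    (h : (extChartAt (𝓡 n) c).symm y ∉ closure {x | divergence vol φ x • ξ x ≠ 0}) :
    divergence vol φ ((extChartAt (𝓡 n) c).symm y) • chartField n φ c y = 0 := by
  have h1 : divergence vol φ ((extChartAt (𝓡 n) c).symm y) •
      ξ ((extChartAt (𝓡 n) c).symm y) = 0 := by
    by_contra hne
    exact h (subset_closure hne)
  rcases smul_eq_zero.1 h1 with h2 | h2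
  · rw [h2, zero_smul]
  · rw [hφ.chartField_eq_zero hy h2, smul_zero]

end Ratio

/-! ### The divergence theorem in a chart -/

section Expansion

variable {n : ℕ} {M : Type*} [TopologicalSpace M] [ChartedSpace (EuclideanSpace ℝ (Fin n)) M]
  {φ : ℝ → M → M} {ξ : VField n M} {vol : NForm n M} {c : M}
  {y : EuclideanSpace ℝ (Fin n)} {ρ : M → ℝ}

/-- The function `h` with `L (L vol) = h vol`. It is the divergence with respect to `vol` of the
field `(div ξ) ξ`, see `IsFlow.expansionRate_mul_chartDensity`. -/
def expansionRate (vol : NForm n M) (φ : ℝ → M → M) : M → ℝ :=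
  formRatio vol (lieDeriv φ (lieDeriv φ vol))

/-- The integral of a function with respect to `|vol|` over the domain of the chart around `c`. -/
def chartIntegral (vol : NForm n M) (c : M) (u : M → ℝ) : ℝ :=
  ∫ y in (extChartAt (𝓡 n) c).target,
    |chartDensity vol c y| * u ((extChartAt (𝓡 n) c).symm y)

lemma continuousOn_chartIntegrand (hvol : IsVolumeElement vol) (c : M) {u : M → ℝ}
    (hu : Continuous u) :
    ContinuousOn (fun y ↦ |chartDensity vol c y| * u ((extChartAt (𝓡 n) c).symm y))
      (extChartAt (𝓡 n) c).target :=
  ((hvol.smooth.contDiffOn_chartDensity c).continuousOn.abs).mul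
    (hu.comp_continuousOn (continuousOn_extChartAt_symm c))

/-- A compact subset of the domain of a chart has compact image in the target of the chart. -/
lemma exists_isCompact_chart {C : Set M} (hC : IsCompact C)
    (hCs : C ⊆ (extChartAt (𝓡 n) c).source) :
    ∃ D ⊆ (extChartAt (𝓡 n) c).target, IsCompact D ∧
      ∀ y ∈ (extChartAt (𝓡 n) c).target \ D, (extChartAt (𝓡 n) c).symm y ∉ C := by
  refine ⟨extChartAt (𝓡 n) c '' C, ?_, hC.image_of_continuousOn
    ((continuousOn_extChartAt c).mono hCs), ?_⟩
  · rintro _ ⟨x, hx, rfl⟩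
    exact (extChartAt (𝓡 n) c).map_source (hCs hx)
  · rintro y ⟨hy, hyD⟩ h
    exact hyD ⟨_, h, (extChartAt (𝓡 n) c).right_inv hy⟩

lemma integrableOn_chart (hvol : IsVolumeElement vol) {u : M → ℝ} (hu : Continuous u)
    {C : Set M} (hC : IsCompact C) (hCs : C ⊆ (extChartAt (𝓡 n) c).source)
    (h0 : ∀ x ∉ C, u x = 0) :
    IntegrableOn (fun y ↦ |chartDensity vol c y| * u ((extChartAt (𝓡 n) c).symm y))
      (extChartAt (𝓡 n) c).target := by
  obtain ⟨D, hDT, hD, h⟩ := exists_isCompact_chart hC hCs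
  refine IntegrableOn.of_forall_sdiff_eq_zero
    (((continuousOn_chartIntegrand hvol c hu).mono hDT).integrableOn_compact hD)
    (isOpen_extChartAt_target c).measurableSet fun y hy ↦ ?_
  rw [h0 _ (h y hy), mul_zero]

/-- Functions that are constant near `x` have vanishing derivative along the flow at `x`. -/
lemma IsFlow.lieDerivFun_eq_zero (hφ : IsFlow φ ξ) {x : M} {k : ℝ} (h : ∀ᶠ z in 𝓝 x, ρ z = k) :
    lieDerivFun φ ρ x = 0 := by
  have h1 : ContinuousAt (fun t : ℝ ↦ φ t x) 0 :=
    ContinuousAt.comp (f := fun t : ℝ ↦ (t, x)) (x := (0 : ℝ)) (hφ.contMDiffAt x).continuousAt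
      (by fun_prop)
  have h0 : ∀ᶠ z in 𝓝 (φ 0 x), ρ z = k := by rwa [hφ.zero]
  have h2 : (fun t ↦ ρ (φ t x)) =ᶠ[𝓝 0] fun _ ↦ k := h1.eventually h0
  exact h2.deriv_eq.trans (deriv_const _ _)

lemma IsFlow.differentiableAt_comp (hφ : IsFlow φ ξ) (hρ : ContMDiff (𝓡 n) 𝓘(ℝ, ℝ) ∞ ρ) (x : M) :
    DifferentiableAt ℝ (fun t ↦ ρ (φ t x)) 0 := by
  have h1 := (hφ.contMDiffAt x).comp (0 : ℝ) (contMDiffAt_id.prodMk contMDiffAt_const)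
  exact (hρ.contMDiffAt.comp (0 : ℝ) h1).contDiffAt.differentiableAt (by simp)

variable [IsManifold (𝓡 n) ∞ M]

lemma contDiffOn_comp_chart_symm (hρ : ContMDiff (𝓡 n) 𝓘(ℝ, ℝ) ∞ ρ) (c : M) :
    ContDiffOn ℝ ∞ (fun y ↦ ρ ((extChartAt (𝓡 n) c).symm y)) (extChartAt (𝓡 n) c).target :=
  (hρ.comp_contMDiffOn (contMDiffOn_extChartAt_symm c)).contDiffOn

lemma IsFlow.contDiffOn_divergence (hφ : IsFlow φ ξ) (hvol : IsVolumeElement vol) (c : M) :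
    ContDiffOn ℝ ∞ (fun y ↦ divergence vol φ ((extChartAt (𝓡 n) c).symm y))
      (extChartAt (𝓡 n) c).target :=
  contDiffOn_formRatio hvol
    (hφ.contDiffOn_chartDensity_lieDeriv (hvol.smooth.contDiffOn_chartDensity c))

lemma IsFlow.continuous_divergence (hφ : IsFlow φ ξ) (hvol : IsVolumeElement vol) :
    Continuous (divergence vol φ) :=
  continuous_of_forall_chart fun c ↦ (hφ.contDiffOn_divergence hvol c).continuousOn

lemma IsFlow.continuous_expansionRate (hφ : IsFlow φ ξ) (hvol : IsVolumeElement vol) :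
    Continuous (expansionRate vol φ) :=
  continuous_of_forall_chart fun c ↦ (contDiffOn_formRatio hvol
    (hφ.contDiffOn_chartDensity_lieDeriv (hφ.contDiffOn_chartDensity_lieDeriv
      (hvol.smooth.contDiffOn_chartDensity c)))).continuousOn

lemma IsFlow.continuous_lieDerivFun (hφ : IsFlow φ ξ) (hρ : ContMDiff (𝓡 n) 𝓘(ℝ, ℝ) ∞ ρ) :
    Continuous (lieDerivFun φ ρ) := by
  refine continuous_of_forall_chart (n := n) fun c ↦ ?_
  have hT := isOpen_extChartAt_target (I := 𝓡 n) c
  have h1 := contDiffOn_comp_chart_symm hρ c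
  refine (((h1.continuousOn_fderiv_of_isOpen hT (by simp)).clm_apply
    (hφ.contDiffOn_chartField c).continuousOn)).congr fun y hy ↦ ?_
  exact hφ.lieDerivFun_chart hy ((h1.contDiffAt (hT.mem_nhds hy)).differentiableAt (by simp))

/-- `L (L vol) = div (div ξ · ξ) vol` in a chart. -/
lemma IsFlow.expansionRate_mul_chartDensity (hφ : IsFlow φ ξ) (hvol : IsVolumeElement vol)
    (hy : y ∈ (extChartAt (𝓡 n) c).target) :
    expansionRate vol φ ((extChartAt (𝓡 n) c).symm y) * chartDensity vol c y =
      euclDiv (fun z ↦ (divergence vol φ ((extChartAt (𝓡 n) c).symm z) * chartDensity vol c z) •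
        chartField n φ c z) y := by
  have hT := isOpen_extChartAt_target (I := 𝓡 n) c
  have h1 := hφ.contDiffOn_chartDensity_lieDeriv (hvol.smooth.contDiffOn_chartDensity c)
  rw [expansionRate, ← chartDensity_eq_formRatio_mul hvol.ne_zero,
    hφ.chartDensity_lieDeriv hy ((h1.contDiffAt (hT.mem_nhds hy)).differentiableAt (by simp))]
  simp only [divergence_eq_formRatio, ← chartDensity_eq_formRatio_mul hvol.ne_zero]

/-- `div (f ξ) = ξ f + f²` for `f = div ξ`. -/
lemma IsFlow.expansionRate_eq (hφ : IsFlow φ ξ) (hvol : IsVolumeElement vol) (x : M) :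
    expansionRate vol φ x = lieDerivFun φ (divergence vol φ) x + divergence vol φ x ^ 2 := by
  have hy := mem_extChartAt_target (I := 𝓡 n) x
  have hx : (extChartAt (𝓡 n) x).symm (extChartAt (𝓡 n) x x) = x := extChartAt_to_inv x
  set y := extChartAt (𝓡 n) x x
  have hT := (isOpen_extChartAt_target (I := 𝓡 n) x).mem_nhds hy
  have hf := ((hφ.contDiffOn_divergence hvol x).contDiffAt hT).differentiableAt (by simp)
  have ha := ((hvol.smooth.contDiffOn_chartDensity x).contDiffAt hT).differentiableAt (by simp)
  have hX := ((hφ.contDiffOn_chartField x).contDiffAt hT).differentiableAt (by simp)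
  have h1 := hφ.expansionRate_mul_chartDensity hvol hy
  simp only [mul_smul] at h1
  rw [euclDiv_smul hf (ha.fun_smul hX), ← hφ.chartDensity_lieDeriv hy ha, map_smul,
    ← hφ.lieDerivFun_chart hy hf, chartDensity_eq_formRatio_mul hvol.ne_zero (lieDeriv φ vol),
    ← divergence_eq_formRatio, hx, smul_eq_mul] at h1
  refine mul_right_cancel₀ (chartDensity_ne_zero hvol.ne_zero hy) (h1.trans ?_)
  ring

/-- The divergence of `(div ξ) ξ` vanishes off the closed support of this field. -/
lemma IsFlow.expansionRate_eq_zero (hφ : IsFlow φ ξ) (hvol : IsVolumeElement vol) {x : M}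
    (hx : x ∉ closure {x | divergence vol φ x • ξ x ≠ 0}) : expansionRate vol φ x = 0 := by
  have hy := mem_extChartAt_target (I := 𝓡 n) x
  have hxy : (extChartAt (𝓡 n) x).symm (extChartAt (𝓡 n) x x) = x := extChartAt_to_inv x
  set y := extChartAt (𝓡 n) x x
  have hT := (isOpen_extChartAt_target (I := 𝓡 n) x).mem_nhds hy
  have h1 := hφ.expansionRate_mul_chartDensity hvol hy
  rw [euclDiv_eq_zero, hxy] at h1
  · exact (mul_eq_zero.1 h1).resolve_right (chartDensity_ne_zero hvol.ne_zero hy)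
  · have h2 := (contMDiffAt_chart_symm hy).continuousAt.eventually_mem
      (isClosed_closure.isOpen_compl.mem_nhds (by rw [hxy]; exact hx))
    filter_upwards [hT, h2] with z hz hz'
    rw [mul_comm, mul_smul, hφ.divergence_smul_chartField_eq_zero hz hz', smul_zero]

/-- `f L ρ` is the derivative of `ρ` in the direction of `f ξ`, so it vanishes where `f ξ` does. -/
lemma IsFlow.divergence_mul_lieDerivFun_eq_zero (hφ : IsFlow φ ξ)
    (hρ : ContMDiff (𝓡 n) 𝓘(ℝ, ℝ) ∞ ρ) {x : M}
    (hx : x ∉ closure {x | divergence vol φ x • ξ x ≠ 0}) :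
    divergence vol φ x * lieDerivFun φ ρ x = 0 := by
  have hy := mem_extChartAt_target (I := 𝓡 n) x
  have hxy : (extChartAt (𝓡 n) x).symm (extChartAt (𝓡 n) x x) = x := extChartAt_to_inv x
  set y := extChartAt (𝓡 n) x x
  have hr := ((contDiffOn_comp_chart_symm hρ x).contDiffAt
    ((isOpen_extChartAt_target (I := 𝓡 n) x).mem_nhds hy)).differentiableAt (by simp)
  have h1 := hφ.lieDerivFun_chart hy hr
  have h2 := hφ.divergence_smul_chartField_eq_zero hy (by rw [hxy]; exact hx)
  rw [hxy] at h1 h2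
  rw [h1, ← smul_eq_mul, ← map_smul, h2, map_zero]

/-- The product rule `div (ρ f ξ) = ρ div (f ξ) + f ξ ρ` in a chart. The density enters through
its absolute value, since the charts need not be oriented. -/
lemma IsFlow.euclDiv_cutoff (hφ : IsFlow φ ξ) (hvol : IsVolumeElement vol)
    (hρ : ContMDiff (𝓡 n) 𝓘(ℝ, ℝ) ∞ ρ) (hy : y ∈ (extChartAt (𝓡 n) c).target) :
    euclDiv (fun z ↦ (|chartDensity vol c z| * ρ ((extChartAt (𝓡 n) c).symm z)) •
        divergence vol φ ((extChartAt (𝓡 n) c).symm z) • chartField n φ c z) y =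
      |chartDensity vol c y| * (ρ ((extChartAt (𝓡 n) c).symm y) *
          expansionRate vol φ ((extChartAt (𝓡 n) c).symm y)) +
        |chartDensity vol c y| * (divergence vol φ ((extChartAt (𝓡 n) c).symm y) *
          lieDerivFun φ ρ ((extChartAt (𝓡 n) c).symm y)) := by
  have hT := (isOpen_extChartAt_target (I := 𝓡 n) c).mem_nhds hy
  have hf := ((hφ.contDiffOn_divergence hvol c).contDiffAt hT).differentiableAt (by simp)
  have ha := ((hvol.smooth.contDiffOn_chartDensity c).contDiffAt hT)
  have hX := ((hφ.contDiffOn_chartField c).contDiffAt hT).differentiableAt (by simp)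
  have hr := ((contDiffOn_comp_chart_symm hρ c).contDiffAt hT).differentiableAt (by simp)
  -- The sign of the nonvanishing density is locally constant.
  obtain ⟨σ, hσ⟩ : ∃ σ : ℝ, ∀ᶠ z in 𝓝 y, |chartDensity vol c z| = σ * chartDensity vol c z := by
    rcases (chartDensity_ne_zero hvol.ne_zero hy).lt_or_gt with h | h
    · refine ⟨-1, ?_⟩
      filter_upwards [ha.continuousAt.eventually_lt_const h] with z hz
      rw [abs_of_neg hz, neg_one_mul]
    · refine ⟨1, ?_⟩
      filter_upwards [ha.continuousAt.eventually_const_lt h] with z hz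
      rw [abs_of_pos hz, one_mul]
  have hW : DifferentiableAt ℝ (fun z ↦
      (divergence vol φ ((extChartAt (𝓡 n) c).symm z) * chartDensity vol c z) •
        chartField n φ c z) y :=
    (hf.fun_mul (ha.differentiableAt (by simp))).fun_smul hX
  rw [euclDiv_congr (W := fun z ↦ (σ * ρ ((extChartAt (𝓡 n) c).symm z)) •
    (divergence vol φ ((extChartAt (𝓡 n) c).symm z) * chartDensity vol c z) •
        chartField n φ c z), euclDiv_smul (hr.const_mul σ) hW,
    ← hφ.expansionRate_mul_chartDensity hvol hy, fderiv_const_mul hr, hσ.self_of_nhds,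
    hφ.lieDerivFun_chart hy hr]
  · simp only [smul_apply, map_smul, smul_eq_mul]
    ring
  · filter_upwards [hσ] with z hz
    rw [hz]
    module

/-- The divergence theorem for the field `ρ (div ξ) ξ`, which has compact support in a chart: an
integration by parts against the cutoff `ρ`. -/
lemma IsFlow.chartIntegral_cutoff [T2Space M] (hφ : IsFlow φ ξ) (hvol : IsVolumeElement vol)
    (hcomp : HasCompactSupportField (fun x ↦ divergence vol φ x • ξ x))
    (hρ : ContMDiff (𝓡 n) 𝓘(ℝ, ℝ) ∞ ρ) (hs : tsupport ρ ⊆ (extChartAt (𝓡 n) c).source) :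
    chartIntegral vol c (fun x ↦ ρ x * expansionRate vol φ x) =
      - chartIntegral vol c (fun x ↦ divergence vol φ x * lieDerivFun φ ρ x) := by
  set K := closure {x | divergence vol φ x • ξ x ≠ 0}
  have hT := isOpen_extChartAt_target (I := 𝓡 n) c
  have hC : IsCompact (K ∩ tsupport ρ) := hcomp.inter_right (isClosed_tsupport ρ)
  have hCs : K ∩ tsupport ρ ⊆ (extChartAt (𝓡 n) c).source := inter_subset_right.trans hs
  obtain ⟨D, hDT, hD, h⟩ := exists_isCompact_chart hC hCs
  have hI1 := integrableOn_chart hvol (u := fun x ↦ ρ x * expansionRate vol φ x)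
    (hρ.continuous.mul (hφ.continuous_expansionRate hvol)) hC hCs fun x hx ↦ by
      by_cases hxK : x ∈ K
      · have : x ∉ tsupport ρ := fun h ↦ hx ⟨hxK, h⟩
        rw [image_eq_zero_of_notMem_tsupport this, zero_mul]
      · rw [hφ.expansionRate_eq_zero hvol hxK, mul_zero]
  have hV : ContDiffOn ℝ 1 (fun z ↦ (|chartDensity vol c z| * ρ ((extChartAt (𝓡 n) c).symm z)) •
      divergence vol φ ((extChartAt (𝓡 n) c).symm z) • chartField n φ c z)
      (extChartAt (𝓡 n) c).target := by
    have ha : ContDiffOn ℝ ∞ (fun z ↦ |chartDensity vol c z|) (extChartAt (𝓡 n) c).target :=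
      (hvol.smooth.contDiffOn_chartDensity c).abs
        fun y hy ↦ chartDensity_ne_zero hvol.ne_zero hy
    exact ((ha.mul (contDiffOn_comp_chart_symm hρ c)).smul ((hφ.contDiffOn_divergence hvol c).smul
      (hφ.contDiffOn_chartField c))).of_le (by norm_cast)
  have hzero : ∀ y ∈ (extChartAt (𝓡 n) c).target \ D,
      (|chartDensity vol c y| * ρ ((extChartAt (𝓡 n) c).symm y)) •
      divergence vol φ ((extChartAt (𝓡 n) c).symm y) • chartField n φ c y = 0 := by
    intro y hy
    by_cases hxK : (extChartAt (𝓡 n) c).symm y ∈ K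
    · have : (extChartAt (𝓡 n) c).symm y ∉ tsupport ρ := fun h' ↦ h y hy ⟨hxK, h'⟩
      rw [image_eq_zero_of_notMem_tsupport this, mul_zero, zero_smul]
    · rw [hφ.divergence_smul_chartField_eq_zero hy.1 hxK, smul_zero]
  have hdiv := setIntegral_euclDiv_eq_zero hT hV hD hDT hzero
  rw [setIntegral_congr_fun hT.measurableSet fun y hy ↦ hφ.euclDiv_cutoff hvol hρ hy] at hdiv
  have hI2 : IntegrableOn (fun y ↦ |chartDensity vol c y| *
      (divergence vol φ ((extChartAt (𝓡 n) c).symm y) *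
        lieDerivFun φ ρ ((extChartAt (𝓡 n) c).symm y))) (extChartAt (𝓡 n) c).target := by
    refine integrableOn_chart hvol (u := fun x ↦ divergence vol φ x * lieDerivFun φ ρ x)
      ((hφ.continuous_divergence hvol).mul (hφ.continuous_lieDerivFun hρ)) hC hCs fun x hx ↦ ?_
    by_cases hxK : x ∈ K
    · have : x ∉ tsupport ρ := fun h ↦ hx ⟨hxK, h⟩
      rw [hφ.lieDerivFun_eq_zero (notMem_tsupport_iff_eventuallyEq.1 this), mul_zero]
    · exact hφ.divergence_mul_lieDerivFun_eq_zero hρ hxK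
  rw [integral_add hI1 hI2] at hdiv
  exact eq_neg_of_add_eq_zero_left hdiv

end Expansion

/-! ### Change of charts and the global divergence theorem -/

section Integral

variable {n : ℕ} {M : Type*} [TopologicalSpace M] [ChartedSpace (EuclideanSpace ℝ (Fin n)) M]
  [IsManifold (𝓡 n) ∞ M] {φ : ℝ → M → M} {ξ : VField n M} {vol : NForm n M} {c d : M}
  {y : EuclideanSpace ℝ (Fin n)}

lemma contDiffAt_transition (hy : y ∈ (extChartAt (𝓡 n) c).target)
    (hyd : (extChartAt (𝓡 n) c).symm y ∈ (extChartAt (𝓡 n) d).source) :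
    ContDiffAt ℝ ∞ (extChartAt (𝓡 n) d ∘ (extChartAt (𝓡 n) c).symm) y := by
  refine contMDiffAt_iff_contDiffAt.1 (ContMDiffAt.comp y ?_ (contMDiffAt_chart_symm hy))
  exact contMDiffAt_extChartAt' (by rwa [← extChartAt_source (𝓡 n)])

/-- The densities of a form in two charts differ by the Jacobian of the transition map. -/
lemma chartDensity_transition (α : NForm n M) (hy : y ∈ (extChartAt (𝓡 n) c).target)
    (hyd : (extChartAt (𝓡 n) c).symm y ∈ (extChartAt (𝓡 n) d).source) :
    chartDensity α c y =
      chartDensity α d (extChartAt (𝓡 n) d ((extChartAt (𝓡 n) c).symm y)) *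
        (fderiv ℝ (extChartAt (𝓡 n) d ∘ (extChartAt (𝓡 n) c).symm) y).det := by
  set τ := extChartAt (𝓡 n) d ∘ (extChartAt (𝓡 n) c).symm
  have hτ : DifferentiableAt ℝ τ y := (contDiffAt_transition hy hyd).differentiableAt (by simp)
  have hyd' : τ y ∈ (extChartAt (𝓡 n) d).target := (extChartAt (𝓡 n) d).map_source hyd
  have h1 : mfderiv (𝓡 n) (𝓡 n) ((extChartAt (𝓡 n) d).symm ∘ τ) y =
      (mfderiv (𝓡 n) (𝓡 n) (extChartAt (𝓡 n) d).symm (τ y)).comp (mfderiv (𝓡 n) (𝓡 n) τ y) :=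
    mfderiv_comp y (mdifferentiableAt_chart_symm hyd') hτ.mdifferentiableAt
  have h2 : (extChartAt (𝓡 n) c).symm =ᶠ[𝓝 y] (extChartAt (𝓡 n) d).symm ∘ τ := by
    filter_upwards [(contMDiffAt_chart_symm hy).continuousAt.eventually_mem
      ((isOpen_extChartAt_source d).mem_nhds hyd)] with z hz
    exact ((extChartAt (𝓡 n) d).left_inv hz).symm
  rw [mfderiv_eq_fderiv] at h1
  have h3 : ∀ w : EuclideanSpace ℝ (Fin n),
      mfderiv (𝓡 n) (𝓡 n) (extChartAt (𝓡 n) c).symm y w =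
      mfderiv (𝓡 n) (𝓡 n) (extChartAt (𝓡 n) d).symm (τ y) (fderiv ℝ τ y w) := fun w ↦
    congrArg (fun A : EuclideanSpace ℝ (Fin n) →L[ℝ] EuclideanSpace ℝ (Fin n) ↦ A w)
      (h2.mfderiv_eq.trans h1)
  rw [← stdDet_map]
  refine Eq.trans ?_ (inChart_apply_eq α d (τ y) fun i ↦ fderiv ℝ τ y (stdFrame n i))
  have h4 := apply_congr_point α ((extChartAt (𝓡 n) d).left_inv hyd).symm
    (fun i ↦ mfderiv (𝓡 n) (𝓡 n) (extChartAt (𝓡 n) c).symm y (stdFrame n i))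
  refine h4.trans ?_
  simp only [h3]
  rfl

/-- Change of variables: the integral of a function supported in two charts is the same in both. -/
lemma chartIntegral_eq (vol : NForm n M) {u : M → ℝ}
    (hc : ∀ x ∉ (extChartAt (𝓡 n) c).source, u x = 0)
    (hd : ∀ x ∉ (extChartAt (𝓡 n) d).source, u x = 0) :
    chartIntegral vol c u = chartIntegral vol d u := by
  set ψ := extChartAt (𝓡 n) c
  set χ := extChartAt (𝓡 n) d
  set S := ψ.target ∩ ψ.symm ⁻¹' χ.source
  have hS : IsOpen S := (continuousOn_extChartAt_symm c).isOpen_inter_preimage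
    (isOpen_extChartAt_target c) (isOpen_extChartAt_source d)
  have hτ : ∀ y ∈ S, HasFDerivWithinAt (χ ∘ ψ.symm) (fderiv ℝ (χ ∘ ψ.symm) y) S y :=
    fun y hy ↦ ((contDiffAt_transition hy.1 hy.2).differentiableAt
      (by simp)).hasFDerivAt.hasFDerivWithinAt
  have hinj : InjOn (χ ∘ ψ.symm) S := χ.injOn.comp
    (ψ.symm.injOn.mono inter_subset_left) fun y hy ↦ hy.2
  have himg : (χ ∘ ψ.symm) '' S = χ.target ∩ χ.symm ⁻¹' ψ.source := by
    ext z
    constructor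
    · rintro ⟨y, hy, rfl⟩
      refine ⟨χ.map_source hy.2, ?_⟩
      rw [mem_preimage, Function.comp_apply, χ.left_inv hy.2]
      exact ψ.map_target hy.1
    · rintro ⟨hz, hz'⟩
      refine ⟨ψ (χ.symm z), ⟨ψ.map_source hz', ?_⟩, ?_⟩
      · rw [mem_preimage, ψ.left_inv hz']
        exact χ.map_target hz
      · rw [Function.comp_apply, ψ.left_inv hz', χ.right_inv hz]
  -- Both integrals reduce to the overlap of the charts, where `u` may be nonzero.
  have h1 : chartIntegral vol d u =
      ∫ z in (χ ∘ ψ.symm) '' S, |chartDensity vol d z| * u (χ.symm z) := by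
    rw [himg]
    refine setIntegral_eq_of_subset_of_forall_sdiff_eq_zero
      (isOpen_extChartAt_target d).measurableSet inter_subset_left fun z hz ↦ ?_
    rw [hc (χ.symm z) fun h ↦ hz.2 ⟨hz.1, h⟩, mul_zero]
  have h2 : chartIntegral vol c u = ∫ y in S, |chartDensity vol c y| * u (ψ.symm y) := by
    refine setIntegral_eq_of_subset_of_forall_sdiff_eq_zero
      (isOpen_extChartAt_target c).measurableSet inter_subset_left fun z hz ↦ ?_
    rw [hd (ψ.symm z) fun h ↦ hz.2 ⟨hz.1, h⟩, mul_zero]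
  rw [h1, h2, integral_image_eq_integral_abs_det_fderiv_smul volume hS.measurableSet hτ hinj]
  refine setIntegral_congr_fun hS.measurableSet fun y hy ↦ ?_
  simp only [Function.comp_apply, smul_eq_mul]
  rw [chartDensity_transition vol hy.1 hy.2, χ.left_inv hy.2, abs_mul]
  ring

/-- A nonnegative continuous function with compact support in a chart and vanishing integral is
zero. -/
lemma eq_zero_of_chartIntegral_eq_zero (hvol : IsVolumeElement vol) {u : M → ℝ} (hu : Continuous u)
    {C : Set M} (hC : IsCompact C) (hCs : C ⊆ (extChartAt (𝓡 n) c).source)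
    (h0 : ∀ x ∉ C, u x = 0) (hpos : ∀ x, 0 ≤ u x) (hI : chartIntegral vol c u = 0) (x : M) :
    u x = 0 := by
  by_cases hx : x ∈ C
  swap
  · exact h0 x hx
  have hT := isOpen_extChartAt_target (I := 𝓡 n) c
  have h1 := (setIntegral_eq_zero_iff_of_nonneg_ae
    (Eventually.of_forall fun y ↦ mul_nonneg (abs_nonneg _) (hpos _))
    (integrableOn_chart hvol hu hC hCs h0)).1 hI
  have h2 := Measure.eqOn_open_of_ae_eq h1 hT (continuousOn_chartIntegrand hvol c hu)
    continuousOn_const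
  have hy := (extChartAt (𝓡 n) c).map_source (hCs hx)
  have h3 := h2 hy
  simp only [(extChartAt (𝓡 n) c).left_inv (hCs hx), Pi.zero_apply] at h3
  exact (mul_eq_zero.1 h3).resolve_left (abs_ne_zero.2 (chartDensity_ne_zero hvol.ne_zero hy))

/-- The divergence theorem for the compactly supported field `(div ξ) ξ`, whose integral is
assembled from the charts by a partition of unity. Each cutoff `ρ j` contributes an error term
`(div ξ) L(ρ j)`, and moving the summands of these terms to a common chart they add up to
`(div ξ) L(∑ j, ρ j) = 0`. -/
lemma IsFlow.sum_chartIntegral_eq_zero [T2Space M] (hφ : IsFlow φ ξ) (hvol : IsVolumeElement vol)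
    (hcomp : HasCompactSupportField (fun x ↦ divergence vol φ x • ξ x))
    (ρ : SmoothPartitionOfUnity M (𝓡 n) M)
    (hsrc : ∀ i, tsupport (ρ i) ⊆ (extChartAt (𝓡 n) i).source) (J : Finset M)
    (hJ : ∀ z ∈ closure {x | divergence vol φ x • ξ x ≠ 0}, ∀ᶠ w in 𝓝 z, ∑ i ∈ J, ρ i w = 1) :
    ∑ j ∈ J, chartIntegral vol j (fun z ↦ ρ j z * expansionRate vol φ z) = 0 := by
  set K := closure {x | divergence vol φ x • ξ x ≠ 0}
  have hsm : ∀ i, ContMDiff (𝓡 n) 𝓘(ℝ, ℝ) ∞ (ρ i) := fun i ↦ (ρ i).contMDiff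
  -- The error term caused by the cutoff `ρ j`.
  let w : M → M → ℝ := fun j z ↦ divergence vol φ z * lieDerivFun φ (ρ j) z
  have hw0 : ∀ j, ∀ z ∉ K, w j z = 0 := fun j z hz ↦
    hφ.divergence_mul_lieDerivFun_eq_zero (hsm j) hz
  have hw1 : ∀ j, ∀ z ∉ tsupport (ρ j), w j z = 0 := fun j z hz ↦ by
    have := hφ.lieDerivFun_eq_zero (notMem_tsupport_iff_eventuallyEq.1 hz)
    simp only [w, this, mul_zero]
  have hwc : ∀ j, Continuous (w j) := fun j ↦
    (hφ.continuous_divergence hvol).mul (hφ.continuous_lieDerivFun (hsm j))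
  have hwsum : ∀ z, ∑ j ∈ J, w j z = 0 := by
    intro z
    by_cases hz : z ∈ K
    swap
    · exact Finset.sum_eq_zero fun j _ ↦ hw0 j z hz
    have h1 := hφ.lieDerivFun_eq_zero (hJ z hz)
    have h2 : lieDerivFun φ (fun z ↦ ∑ j ∈ J, ρ j z) z = ∑ j ∈ J, lieDerivFun φ (ρ j) z :=
      deriv_fun_sum fun j _ ↦ hφ.differentiableAt_comp (hsm j) z
    simp only [w]
    rw [← Finset.mul_sum, ← h2, h1, mul_zero]
  have hK : IsCompact K := hcomp
  have hcpt : ∀ i, IsCompact (K ∩ tsupport (ρ i)) := fun i ↦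
    hK.inter_right (isClosed_tsupport _)
  have hcs : ∀ i, K ∩ tsupport (ρ i) ⊆ (extChartAt (𝓡 n) i).source := fun i ↦
    inter_subset_right.trans (hsrc i)
  have hint : ∀ i j k, k = i ∨ k = j → IntegrableOn (fun y ↦ |chartDensity vol k y| *
      (ρ i ((extChartAt (𝓡 n) k).symm y) * w j ((extChartAt (𝓡 n) k).symm y)))
      (extChartAt (𝓡 n) k).target := by
    intro i j k hk
    refine integrableOn_chart hvol (u := fun z ↦ ρ i z * w j z)
      ((hsm i).continuous.mul (hwc j)) (hcpt k) (hcs k) fun z hz ↦ ?_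
    by_cases hzK : z ∈ K
    · have hz' : z ∉ tsupport (ρ k) := fun h ↦ hz ⟨hzK, h⟩
      rcases hk with rfl | rfl
      · rw [image_eq_zero_of_notMem_tsupport hz', zero_mul]
      · rw [hw1 k z hz', mul_zero]
    · rw [hw0 j z hzK, mul_zero]
  calc ∑ j ∈ J, chartIntegral vol j (fun z ↦ ρ j z * expansionRate vol φ z)
      = ∑ j ∈ J, - chartIntegral vol j (w j) := Finset.sum_congr rfl fun j _ ↦
        hφ.chartIntegral_cutoff hvol hcomp (hsm j) (hsrc j)
    _ = - ∑ j ∈ J, ∑ i ∈ J, chartIntegral vol j (fun z ↦ ρ i z * w j z) := by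
        rw [Finset.sum_neg_distrib]
        congr 1
        refine Finset.sum_congr rfl fun j _ ↦ ?_
        unfold chartIntegral
        rw [← integral_finsetSum _ fun i _ ↦ hint i j j (Or.inr rfl)]
        refine integral_congr_ae (Eventually.of_forall fun y ↦ ?_)
        simp only
        rw [← Finset.mul_sum, ← Finset.sum_mul]
        by_cases hz : (extChartAt (𝓡 n) j).symm y ∈ K
        · rw [(hJ _ hz).self_of_nhds, one_mul]
        · simp only [hw0 j _ hz, mul_zero]
    _ = - ∑ j ∈ J, ∑ i ∈ J, chartIntegral vol i (fun z ↦ ρ i z * w j z) := by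
        congr 1
        refine Finset.sum_congr rfl fun j _ ↦ Finset.sum_congr rfl fun i _ ↦ ?_
        -- `ρ i * w j` is supported in both charts around `i` and `j`, so it
        -- may be integrated in either.
        refine chartIntegral_eq vol (fun z hz ↦ ?_) (fun z hz ↦ ?_)
        · rw [hw1 j z fun h ↦ hz (hsrc j h), mul_zero]
        · rw [image_eq_zero_of_notMem_tsupport fun h ↦ hz (hsrc i h), zero_mul]
    _ = - ∑ i ∈ J, ∑ j ∈ J, chartIntegral vol i (fun z ↦ ρ i z * w j z) := by
        rw [Finset.sum_comm]
    _ = 0 := by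
        rw [neg_eq_zero]
        refine Finset.sum_eq_zero fun i _ ↦ ?_
        unfold chartIntegral
        rw [← integral_finsetSum _ fun j _ ↦ hint i j i (Or.inl rfl)]
        simp [← Finset.mul_sum, hwsum]

/-- If the divergence of the compactly supported field `(div ξ) ξ` has constant sign, it vanishes.
The sign is that of the factor `s`, which covers nonnegative and nonpositive divergences at once. -/
theorem IsFlow.expansionRate_eq_zero_of_sign [T2Space M] [SecondCountableTopology M]
    (hφ : IsFlow φ ξ) (hvol : IsVolumeElement vol)
    (hcomp : HasCompactSupportField (fun x ↦ divergence vol φ x • ξ x))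
    (s : ℝ) (hs : s ≠ 0) (hpos : ∀ x, 0 ≤ s * expansionRate vol φ x) (x : M) :
    expansionRate vol φ x = 0 := by
  have : LocallyCompactSpace M := Manifold.locallyCompact_of_finiteDimensional (𝓡 n)
  set K := closure {x | divergence vol φ x • ξ x ≠ 0}
  have hK : IsCompact K := hcomp
  obtain ⟨ρ, hρ⟩ := SmoothPartitionOfUnity.exists_isSubordinate_chartAt_source (𝓡 n) M
  have hsrc : ∀ i, tsupport (ρ i) ⊆ (extChartAt (𝓡 n) i).source := fun i ↦ by
    rw [extChartAt_source]
    exact hρ i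
  have hsm : ∀ i, ContMDiff (𝓡 n) 𝓘(ℝ, ℝ) ∞ (ρ i) := fun i ↦ (ρ i).contMDiff
  have hfin : {i | (tsupport (ρ i) ∩ K).Nonempty}.Finite :=
    ρ.locallyFinite.closure.finite_nonempty_inter_compact hK
  -- `J` is defined by the closed supports, so that the functions outside `J` vanish not only on `K`
  -- but near every point of `K`.
  set J := hfin.toFinset
  have hJ : ∀ z ∈ K, ∀ᶠ w in 𝓝 z, ∑ i ∈ J, ρ i w = 1 := by
    intro z hz
    filter_upwards [ρ.eventually_finsupport_subset z] with w hw
    refine ρ.toPartitionOfUnity.sum_finsupport' (mem_univ w) ?_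
    refine hw.trans fun i hi ↦ ?_
    rw [Set.Finite.mem_toFinset]
    exact ⟨z, (ρ.mem_fintsupport_iff z i).1 hi, hz⟩
  have hsum := hφ.sum_chartIntegral_eq_zero hvol hcomp ρ hsrc J hJ
  set h := expansionRate vol φ
  have hcpt : ∀ i, IsCompact (K ∩ tsupport (ρ i)) := fun i ↦
    hK.inter_right (isClosed_tsupport _)
  have hcs : ∀ i, K ∩ tsupport (ρ i) ⊆ (extChartAt (𝓡 n) i).source := fun i ↦
    inter_subset_right.trans (hsrc i)
  have hsh : ∀ j, chartIntegral vol j (fun z ↦ ρ j z * (s * h z)) =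
      s * chartIntegral vol j (fun z ↦ ρ j z * h z) := by
    intro j
    unfold chartIntegral
    rw [← integral_const_mul]
    congr 1
    ext y
    ring
  have hnn : ∀ j z, 0 ≤ ρ j z * (s * h z) := fun j z ↦ mul_nonneg (ρ.nonneg j z) (hpos z)
  have hzero : ∀ j ∈ J, chartIntegral vol j (fun z ↦ ρ j z * (s * h z)) = 0 := by
    refine (Finset.sum_eq_zero_iff_of_nonneg fun j _ ↦ ?_).1 ?_
    · exact integral_nonneg fun y ↦ mul_nonneg (abs_nonneg _) (hnn j _)
    · simp only [hsh]
      rw [← Finset.mul_sum, hsum, mul_zero]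
  by_cases hx : x ∈ K
  swap
  · exact hφ.expansionRate_eq_zero hvol hx
  have hx1 : ∀ j ∈ J, ρ j x * (s * h x) = 0 := fun j hj ↦
    eq_zero_of_chartIntegral_eq_zero hvol (u := fun z ↦ ρ j z * (s * h z))
      ((hsm j).continuous.mul (continuous_const.mul (hφ.continuous_expansionRate hvol)))
      (hcpt j) (hcs j) (fun z hz ↦ by
        by_cases hzK : z ∈ K
        · rw [image_eq_zero_of_notMem_tsupport fun h ↦ hz ⟨hzK, h⟩, zero_mul]
        · have hz0 : h z = 0 := hφ.expansionRate_eq_zero hvol hzK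
          rw [hz0, mul_zero, mul_zero]) (hnn j) (hzero j hj) x
  have h1 : s * h x = 0 := by
    rw [← one_mul (s * h x), ← (hJ x hx).self_of_nhds, Finset.sum_mul]
    exact Finset.sum_eq_zero hx1
  exact (mul_eq_zero.1 h1).resolve_left hs

end Integral

end VolumetricExpansion

end

open VolumetricExpansion in
theorem proposition2 {n : ℕ} (hn : 2 ≤ n) {M : Type*} [TopologicalSpace M]
    [ChartedSpace (EuclideanSpace ℝ (Fin n)) M] [IsManifold (𝓡 n) ∞ M]
    [T2Space M] [SecondCountableTopology M] [ConnectedSpace M]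
    (vol : NForm n M) (hvol : IsVolumeElement vol)
    (ξ : VField n M) (hξ : IsSmoothField ξ)
    (φ : ℝ → M → M) (hφ : IsFlow φ ξ)
    (hcomp : HasCompactSupportField (fun x ↦ divergence vol φ x • ξ x)) :
    -- the rate of volumetric expansion cannot strictly increase or decrease
    ¬ IsPos vol (lieDeriv φ (lieDeriv φ vol)) ∧
    ¬ IsPos vol (-lieDeriv φ (lieDeriv φ vol)) ∧
    -- a nondecreasing or nonincreasing rate of volumetric expansion is constant
    (IsNonneg vol (lieDeriv φ (lieDeriv φ vol)) → lieDeriv φ (lieDeriv φ vol) = 0) ∧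
    (IsNonneg vol (-lieDeriv φ (lieDeriv φ vol)) → lieDeriv φ (lieDeriv φ vol) = 0) ∧
    -- a nondecreasing logarithmic rate of volumetric expansion vanishes
    ((∀ x, 0 ≤ lieDerivFun φ (divergence vol φ) x) →
      (∀ x, divergence vol φ x = 0) ∧ lieDeriv φ vol = 0) := by
  have hn0 : n ≠ 0 := by omega
  have hzero : ∀ s : ℝ, s ≠ 0 → (∀ x, 0 ≤ s * expansionRate vol φ x) →
      lieDeriv φ (lieDeriv φ vol) = 0 := fun s hs h ↦ by
    funext x
    ext v
    rw [apply_eq_formRatio_mul (hvol.ne_zero x) (lieDeriv φ (lieDeriv φ vol)) v]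
    change expansionRate vol φ x * _ = _
    rw [hφ.expansionRate_eq_zero_of_sign hvol hcomp s hs h x, zero_mul]
    rfl
  have hnonneg : ∀ (s : ℝ) (α : NForm n M),
      (∀ x v, α x v = s * lieDeriv φ (lieDeriv φ vol) x v) → IsNonneg vol α →
      ∀ x, 0 ≤ s * expansionRate vol φ x := fun s α hα h x ↦ by
    obtain ⟨v, hv⟩ := exists_apply_pos hn0 (hvol.ne_zero x)
    have h1 := h x v hv
    rw [hα, apply_eq_formRatio_mul (hvol.ne_zero x), ← mul_assoc] at h1
    exact nonneg_of_mul_nonneg_left h1 hv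
  have hpos : IsNonneg vol (lieDeriv φ (lieDeriv φ vol)) → lieDeriv φ (lieDeriv φ vol) = 0 :=
    fun h ↦ hzero 1 one_ne_zero (hnonneg 1 _ (fun x v ↦ (one_mul _).symm) h)
  have hneg : IsNonneg vol (-lieDeriv φ (lieDeriv φ vol)) → lieDeriv φ (lieDeriv φ vol) = 0 :=
    fun h ↦ hzero (-1) (by norm_num) (hnonneg (-1) _ (fun x v ↦ (neg_one_mul _).symm) h)
  obtain ⟨x₀⟩ : Nonempty M := inferInstance
  obtain ⟨v₀, hv₀⟩ := exists_apply_pos hn0 (hvol.ne_zero x₀)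
  refine ⟨fun h ↦ ?_, fun h ↦ ?_, hpos, hneg, fun h ↦ ?_⟩
  · have h1 := h x₀ v₀ hv₀
    rw [hpos fun x v hv ↦ (h x v hv).le] at h1
    exact lt_irrefl _ h1
  · have h1 := h x₀ v₀ hv₀
    rw [hneg fun x v hv ↦ (h x v hv).le, neg_zero] at h1
    exact lt_irrefl _ h1
  -- `L f ≥ 0` gives `h = L f + f² ≥ 0`, so that `h` and with it `f²` vanish.
  · have h1 : ∀ x, divergence vol φ x = 0 := fun x ↦ by
      have h2 := hφ.expansionRate_eq_zero_of_sign hvol hcomp 1 one_ne_zero (fun x ↦ by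
        rw [one_mul, hφ.expansionRate_eq hvol]
        exact add_nonneg (h x) (sq_nonneg _)) x
      rw [hφ.expansionRate_eq hvol] at h2
      exact pow_eq_zero_iff two_ne_zero |>.1 (by nlinarith [h x, sq_nonneg (divergence vol φ x)])
    refine ⟨h1, ?_⟩
    funext x
    rw [lieDeriv_eq_divergence_smul vol hvol.ne_zero, h1, zero_smul]
    rfl
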